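/- Let $m,n,s\ge 0$ be integers and let $\beta>0$ and $\alpha,\gamma>-1$ be real with $\alpha,\gamma>-1/\beta$. Let $\omega_{\alpha,\gamma}(x)=(1-x)^{\alpha}(1+x)^{\gamma}$, and let $$P_n^{(\alpha,\gamma)}(x)=\frac1{n!}\sum_{k=0}^{n}\binom nk(\alpha+\gamma+n+1)_k\,(\alpha+k+1)_{n-k}\Big(\frac{x-1}{2}\Big)^k$$ be the Jacobi polynomials, orthogonal on $(-1,1)$ with respect to $\omega_{\alpha,\gamma}$. Here $(a)_p=\Gamma(a+p)/\Gamma(a)$, $p\in\mathbb Z$, is the Pochhammer symbol (so $(a)_p=a(a+1)\cdots(a+p-1)$ for $p\ge0$ and $(a)_{-p}=1/((a-p)\cdots(a-1))$ for $p>0$), and ${}_3F_2$, ${}_2F_1$ are the (here terminating) hypergeometric series. Then the integral $$\mathcal J_{m,n}(s,\alpha,\gamma,\beta)=\int_{-1}^{1}x^{s}\,[\omega_{\alpha,\gamma}(x)]^{\beta}\,P_m^{(\alpha,\gamma)}(x)\,P_n^{(\alpha,\gamma)}(x)\,dx$$ converges absolutely and $$\mathcal J_{m,n}(s,\alpha,\gamma,\beta)=\sum_{k=|n-m|}^{n+m}b_{nmk}^{(\alpha,\gamma)}\sum_{j=0}^{k}c_{kj}^{(\alpha,\gamma)}(\beta)\,d_j^{(\alpha,\gamma)}(s,\beta)\,\frac{2^{\beta(\alpha+\gamma)+1}\,\Gamma(j+\alpha\beta+1)\,\Gamma(j+\beta\gamma+1)}{j!\,(\beta(\alpha+\gamma)+2j+1)\,\Gamma(\beta(\alpha+\gamma)+j+1)},$$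 where $$\begin{aligned} b_{nmk}^{(\alpha,\gamma)}={}&\frac{k!\,\Gamma(\alpha+\gamma+k+1)\,\Gamma(\alpha+\gamma+2n+1)\,\Gamma(\alpha+\gamma+2m+1)}{n!\,m!\,\Gamma(\alpha+\gamma+2k+1)\,\Gamma(\alpha+\gamma+n+1)\,\Gamma(\alpha+\gamma+m+1)}\\ &\times\sum_{t=\max\{0,k-m\}}^{\min\{k,n\}}\binom nt\binom m{k-t}\frac{(\alpha+t+1)_{n-t}}{(\alpha+\gamma+n+t+1)_{n-t}}\\ &\times\sum_{w=0}^{m+t-k}\binom{m+t-k}{w}\frac{(-1)^w(\alpha+\gamma+2m+1)_{k+w-m-t}\,(\alpha+k+1)_w}{(\alpha+m+1)_{k+w-m-t}\,(\alpha+\gamma+2k+2)_w}\\ &\times{}_3F_2(t-n,\ \alpha+\gamma+n+t+1,\ \alpha+k+w+1;\ \alpha+t+1,\ \alpha+\gamma+2k+w+2;\ 1),\\ c_{kj}^{(\alpha,\gamma)}(\beta)={}&\frac{(\alpha+\gamma+k+1)_j\,(\alpha+j+1)_{k-j}\,(\beta(\alpha+\gamma)+2j+1)\,\Gamma(\beta(\alpha+\gamma)+j+1)}{(k-j)!\,\Gamma(\beta(\alpha+\gamma)+2j+2)}\\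 &\times{}_3F_2(-k+j,\ \alpha+\gamma+k+j+1,\ \alpha\beta+j+1;\ \alpha+j+1,\ \beta(\alpha+\gamma)+2j+2;\ 1),\\ d_j^{(\alpha,\gamma)}(s,\beta)={}&(-1)^{s-j}\binom sj\,{}_2F_1(j-s,\ \beta\gamma+j+1;\ \beta(\alpha+\gamma)+2j+2;\ 2)\,\frac{2^j\,j!\,\Gamma(\beta(\alpha+\gamma)+j+1)}{\Gamma(\beta(\alpha+\gamma)+2j+1)}, \end{aligned}$$ with $d_j^{(\alpha,\gamma)}(s,\beta)=0$ for $j>s$. At the parameters with $\alpha+\gamma=-1$ or $\beta(\alpha+\gamma)=-1$, where some of the factors printed above are singular, the right-hand side is read as its limit along parameters $(\alpha',\gamma',\beta')\to(\alpha,\gamma,\beta)$ with $\alpha'+\gamma'\ne-1$ and $\beta'(\alpha'+\gamma')\ne-1$. -/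

import Mathlib

open Topology

noncomputable section

namespace JacobiKrein

/-- The Pochhammer symbol `(a)_p = Γ(a + p) / Γ(a)` with an integer index `p`: it is
`a (a + 1) ⋯ (a + p - 1)` for `p ≥ 0` and `1 / ((a + p) (a + p + 1) ⋯ (a - 1))` for `p < 0`. -/
def poch (a : ℝ) : ℤ → ℝ
  | Int.ofNat p => (ascPochhammer ℝ p).eval a
  | Int.negSucc p => ((ascPochhammer ℝ (p + 1)).eval (a - ((p : ℝ) + 1)))⁻¹

/-- The generalized hypergeometric series `₃F₂(a₁, a₂, a₃; b₁, b₂; z)`. -/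
def hyp3F2 (a₁ a₂ a₃ b₁ b₂ z : ℝ) : ℝ :=
  ∑' i : ℕ, poch a₁ i * poch a₂ i * poch a₃ i / (poch b₁ i * poch b₂ i) * (z ^ i / i.factorial)

/-- The Jacobi polynomial `P_n^{(α,γ)}`, normalized by `P_n^{(α,γ)}(1) = (α + 1)_n / n!`. -/
def jacobiP (n : ℕ) (α γ : ℝ) : Polynomial ℝ :=
  ∑ k ∈ Finset.range (n + 1),
    Polynomial.C ((n.choose k : ℝ) * poch (α + γ + n + 1) k * poch (α + k + 1) ((n : ℤ) - k)
        / n.factorial)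
      * (Polynomial.C (1 / 2 : ℝ) * (Polynomial.X - 1)) ^ k

/-- The Jacobi weight `ω_{α,γ}(x) = (1 - x)^α (1 + x)^γ`. -/
def jacobiWeight (α γ x : ℝ) : ℝ := (1 - x) ^ α * (1 + x) ^ γ

/-- The integrand `x^s [ω_{α,γ}(x)]^β P_m^{(α,γ)}(x) P_n^{(α,γ)}(x)`. -/
def kreinIntegrand (m n s : ℕ) (α γ β x : ℝ) : ℝ :=
  x ^ s * (jacobiWeight α γ x) ^ β * (jacobiP m α γ).eval x * (jacobiP n α γ).eval x

/-- The Krein-like functional `J_{m,n}(s, α, γ, β)`. -/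
def kreinFunctional (m n s : ℕ) (α γ β : ℝ) : ℝ :=
  ∫ x in (-1 : ℝ)..1, kreinIntegrand m n s α γ β x

/-- The linearization coefficient `b_{nmk}^{(α,γ)}`. The truncated difference `k - m` in the lower
limit of the sum over `t` is `max {0, k - m}`; in that sum `m + t - k` is never truncated. -/
def linCoeff (n m k : ℕ) (α γ : ℝ) : ℝ :=
  (k.factorial * Real.Gamma (α + γ + k + 1) * Real.Gamma (α + γ + 2 * n + 1)
      * Real.Gamma (α + γ + 2 * m + 1))
    / (n.factorial * m.factorial * Real.Gamma (α + γ + 2 * k + 1) * Real.Gamma (α + γ + n + 1)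
      * Real.Gamma (α + γ + m + 1))
  * ∑ t ∈ Finset.Icc (k - m) (min k n),
      (n.choose t : ℝ) * (m.choose (k - t) : ℝ)
        * (poch (α + t + 1) ((n : ℤ) - t) / poch (α + γ + n + t + 1) ((n : ℤ) - t))
        * ∑ w ∈ Finset.range (m + t - k + 1),
            ((m + t - k).choose w : ℝ)
              * ((-1) ^ w * poch (α + γ + 2 * m + 1) ((k : ℤ) + w - m - t) * poch (α + k + 1) w
                / (poch (α + m + 1) ((k : ℤ) + w - m - t) * poch (α + γ + 2 * k + 2) w))
              * hyp3F2 ((t : ℝ) - n) (α + γ + n + t + 1) (α + k + w + 1)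
                  (α + t + 1) (α + γ + 2 * k + w + 2) 1

/-- The connection coefficient `c_{kj}^{(α,γ)}(β)`, for `j ≤ k`. -/
def connCoeff (k j : ℕ) (α γ β : ℝ) : ℝ :=
  (poch (α + γ + k + 1) j * poch (α + j + 1) ((k : ℤ) - j) * (β * (α + γ) + 2 * j + 1)
      * Real.Gamma (β * (α + γ) + j + 1))
    / ((k - j).factorial * Real.Gamma (β * (α + γ) + 2 * j + 2))
  * hyp3F2 (-(k : ℝ) + j) (α + γ + k + j + 1) (α * β + j + 1)
      (α + j + 1) (β * (α + γ) + 2 * j + 2) 1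

/-- The inversion coefficient `d_j^{(α,γ)}(s, β)`; it is `0` for `j > s`, by the binomial
coefficient, and the hypergeometric series terminates for `j ≤ s`. -/
def invCoeff (j s : ℕ) (α γ β : ℝ) : ℝ :=
  (-1 : ℝ) ^ ((s : ℤ) - j) * (s.choose j : ℝ)
    * ordinaryHypergeometric ((j : ℝ) - s) (β * γ + j + 1) (β * (α + γ) + 2 * j + 2) (2 : ℝ)
    * (2 ^ j * j.factorial * Real.Gamma (β * (α + γ) + j + 1)
      / Real.Gamma (β * (α + γ) + 2 * j + 1))

/-- The Jacobi norm with parameters `(αβ, γβ)`. -/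
def jacobiNorm (j : ℕ) (α γ β : ℝ) : ℝ :=
  (2 : ℝ) ^ (β * (α + γ) + 1) * Real.Gamma (j + α * β + 1) * Real.Gamma (j + β * γ + 1)
    / (j.factorial * (β * (α + γ) + 2 * j + 1) * Real.Gamma (β * (α + γ) + j + 1))

/-- The triple sum
`∑_{k=|n-m|}^{n+m} b_{nmk} ∑_{j=0}^{k} c_{kj}(β) d_j(s, β) × (Jacobi norm)`. -/
def kreinSum (m n s : ℕ) (α γ β : ℝ) : ℝ :=
  ∑ k ∈ Finset.Icc ((n : ℤ) - m).natAbs (n + m),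
    linCoeff n m k α γ *
      ∑ j ∈ Finset.range (k + 1),
        connCoeff k j α γ β * invCoeff j s α γ β * jacobiNorm j α γ β

/-- The parameters `(α, γ, β)` at which no Gamma function in the coefficients meets its pole at `0`
and no denominator vanishes (for `α, γ, αβ, γβ > -1`). -/
def regularParams : Set (ℝ × ℝ × ℝ) :=
  {p | p.1 + p.2.1 ≠ -1 ∧ p.2.2 * (p.1 + p.2.1) ≠ -1}

end JacobiKrein

end

/-! With `y = (1 - x) / 2` the integral becomes the total mass of the weight `(1 - x)^(αβ) (1 +
x)^(βγ)` times the mean of a polynomial in `y` under a Beta law, whose `p`-th moment is `(u)_p /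
(v)_p` with `u = αβ + 1`, `v = β(α + γ) + 2`. Such a mean is a linear functional `mom u v` on
polynomials, so everything except the Beta integral itself is finite algebra.

The engine is `jac_expansion`: the `k`-th Jacobi coefficient of `Q` is `(-1)^k / (l + k + 1)_k`
times the mean of the `k`-th derivative of `Q` under the weight with both exponents raised by `k`
(Rodrigues' formula integrated by parts, with `l = α + γ`). Applied to `P_n P_m` it gives `b_{nmk}`
through the Leibniz rule; applied to `P_k` with the exponents `αβ, βγ` it gives `c_{kj}`. The
product of `d_j` and the norm is the integral of `x^s P_j`, with `P_j` and the weight both taken at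
the exponents `αβ, βγ`. By linearity the triple sum is the integral at regular parameters
(`kreinSum_eq_mom`).

The mass and the moment are continuous in the parameters, also where `α + γ = -1` or `β(α + γ) =
-1`; only the printed factors are singular there. Hence the limit of the triple sum is the integral.
-/

noncomputable section

namespace JacobiKrein

open Polynomial Finset


/-! ### Rising factorials and terminating hypergeometric sums. -/

/-- The rising factorial `a (a + 1) ⋯ (a + n - 1)`. -/
def rf (a : ℝ) (n : ℕ) : ℝ := (ascPochhammer ℝ n).eval a

@[simp] lemma rf_zero (a : ℝ) : rf a 0 = 1 := by simp [rf]

lemma rf_succ (a : ℝ) (n : ℕ) : rf a (n + 1) = rf a n * (a + n) :=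
  ascPochhammer_succ_eval n a

lemma rf_add (a : ℝ) (m n : ℕ) : rf a (m + n) = rf a m * rf (a + m) n := by
  induction n with
  | zero => simp
  | succ n ih =>
    rw [← add_assoc, rf_succ, ih, rf_succ]
    push_cast
    ring

lemma rf_succ_left (a : ℝ) (n : ℕ) : rf a (n + 1) = a * rf (a + 1) n := by
  rw [add_comm, rf_add]
  simp [rf]

lemma rf_pos {a : ℝ} (ha : 0 < a) (n : ℕ) : 0 < rf a n := ascPochhammer_pos n a ha

lemma rf_ne_zero {a : ℝ} (ha : 0 < a) (n : ℕ) : rf a n ≠ 0 := (rf_pos ha n).ne'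

lemma continuous_rf (n : ℕ) : Continuous fun a => rf a n := (ascPochhammer ℝ n).continuous

lemma rf_neg_natCast (N i : ℕ) : rf (-(N : ℝ)) i = (-1) ^ i * i.factorial * N.choose i := by
  rw [rf, ascPochhammer_eval_neg_eq_descPochhammer, descPochhammer_eval_eq_descFactorial,
    Nat.descFactorial_eq_factorial_mul_choose]
  push_cast
  ring

lemma rf_natCast_sub (r j : ℕ) : rf ((r : ℝ) - j + 1) j = r.descFactorial j := by
  rw [rf, ← descPochhammer_eval_eq_ascPochhammer, descPochhammer_eval_eq_descFactorial]

lemma Gamma_add_natCast {a : ℝ} {n : ℕ} (h : ∀ k < n, a + k ≠ 0) :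
    Real.Gamma (a + n) = rf a n * Real.Gamma a := by
  induction n with
  | zero => simp
  | succ n ih =>
    rw [Nat.cast_succ, ← add_assoc, Real.Gamma_add_one (h n (by simp)),
      ih fun k hk => h k (by lia), rf_succ]
    ring

lemma Gamma_add_natCast_of_pos {a : ℝ} (ha : 0 < a) (n : ℕ) :
    Real.Gamma (a + n) = rf a n * Real.Gamma a :=
  Gamma_add_natCast fun k _ => by positivity

lemma poch_natCast (a : ℝ) (n : ℕ) : poch a n = rf a n := rfl

lemma poch_natCast_sub (a : ℝ) {k n : ℕ} (h : k ≤ n) : poch a ((n : ℤ) - k) = rf a (n - k) := by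
  rw [← Nat.cast_sub h, poch_natCast]

lemma poch_neg_natCast (a : ℝ) (q : ℕ) : poch a (-(q : ℤ)) = (rf (a - q) q)⁻¹ := by
  cases q with
  | zero => simpa using poch_natCast a 0
  | succ q =>
    change poch a (Int.negSucc q) = _
    simp [poch, rf]

/-- A terminating `₃F₂` series is a finite sum. -/
lemma hyp3F2_neg_natCast (N : ℕ) (a₂ a₃ b₁ b₂ : ℝ) :
    hyp3F2 (-(N : ℝ)) a₂ a₃ b₁ b₂ 1 = ∑ i ∈ range (N + 1),
      (-1) ^ i * N.choose i * (rf a₂ i * rf a₃ i / (rf b₁ i * rf b₂ i)) := by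
  rw [hyp3F2, tsum_eq_sum (s := range (N + 1))]
  · refine sum_congr rfl fun i _ => ?_
    simp only [poch_natCast, rf_neg_natCast]
    have : (i.factorial : ℝ) ≠ 0 := by positivity
    field_simp
    simp
  · intro i hi
    simp only [poch_natCast, rf_neg_natCast]
    rw [Nat.choose_eq_zero_of_lt (by simpa using hi)]
    simp

/-- A terminating `₂F₁` series is a finite sum. -/
lemma ordinaryHypergeometric_neg_natCast (N : ℕ) (b c x : ℝ) :
    ordinaryHypergeometric (-(N : ℝ)) b c x = ∑ i ∈ range (N + 1),
      (-1) ^ i * N.choose i * (rf b i / rf c i) * x ^ i := by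
  rw [ordinaryHypergeometric_eq_tsum]
  change ∑' i : ℕ, ((i.factorial : ℝ)⁻¹ * rf (-(N : ℝ)) i * rf b i * (rf c i)⁻¹) * x ^ i = _
  rw [tsum_eq_sum (s := range (N + 1))]
  · refine sum_congr rfl fun i _ => ?_
    rw [rf_neg_natCast]
    have : (i.factorial : ℝ) ≠ 0 := by positivity
    field_simp
  · intro i hi
    rw [rf_neg_natCast, Nat.choose_eq_zero_of_lt (by simpa using hi)]
    simp

/-- The Chu–Vandermonde identity `₂F₁(-j, a; b; 1) = (b - a)_j / (b)_j`. -/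
lemma chu_vandermonde (j : ℕ) (a : ℝ) {b : ℝ} (hb : 0 < b) :
    ∑ i ∈ range (j + 1), (-1) ^ i * j.choose i * (rf a i / rf b i) = rf (b - a) j / rf b j := by
  induction j generalizing a b with
  | zero => simp
  | succ j ih =>
    -- Pascal's rule splits the binomial; in the shifted half, `(a)_{i+1} / (b)_{i+1}` is `a / b`
    -- times the same quotient at `a + 1, b + 1`.
    have pascal : ∑ i ∈ range (j + 2), (-1) ^ i * (j + 1).choose i * (rf a i / rf b i)
        = ∑ i ∈ range (j + 1), (-1) ^ i * j.choose i * (rf a i / rf b i)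
          - a / b * ∑ i ∈ range (j + 1), (-1) ^ i * j.choose i * (rf (a + 1) i / rf (b + 1) i) := by
      have e : ∑ i ∈ range (j + 1), (-1) ^ i * (j.choose i : ℝ) * (rf a i / rf b i)
          = ∑ i ∈ range (j + 2), (-1) ^ i * (j.choose i : ℝ) * (rf a i / rf b i) := by
        rw [sum_range_succ _ (j + 1)]
        simp
      rw [e, sum_range_succ', sum_range_succ' _ (j + 1), mul_sum, add_sub_right_comm,
        ← sum_sub_distrib]
      congr 1
      · refine sum_congr rfl fun i _ => ?_
        rw [Nat.choose_succ_succ, rf_succ_left, rf_succ_left, Nat.cast_add, mul_div_mul_comm]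
        ring
      · simp
    rw [pascal, ih a hb, ih (a + 1) (by positivity), add_sub_add_right_eq_sub, rf_succ]
    have h₁ : rf b (j + 1) = b * rf (b + 1) j := rf_succ_left b j
    have h₂ : rf b (j + 1) = rf b j * (b + j) := rf_succ b j
    have := rf_ne_zero hb j
    have := rf_ne_zero (a := b + 1) (by positivity) j
    have : b + j ≠ 0 := by positivity
    have key : rf (b + 1) j = rf b j * (b + j) / b := by
      rw [← h₂, h₁]
      field_simp
    rw [h₂, key]
    field_simp
    ring

/-! ### Moments of the Beta law, as a functional on polynomials. -/

/-- The linear functional with moments `(u)_p / (v)_p`. -/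
def mom (u v : ℝ) : ℝ[X] →ₗ[ℝ] ℝ :=
  Polynomial.lsum fun p => (rf u p / rf v p) • LinearMap.id

lemma mom_monomial (u v c : ℝ) (p : ℕ) : mom u v (monomial p c) = c * (rf u p / rf v p) := by
  rw [mom, Polynomial.lsum_apply, Polynomial.sum_monomial_index] <;> simp [mul_comm]

lemma mom_X_pow (u v : ℝ) (p : ℕ) : mom u v (X ^ p) = rf u p / rf v p := by
  rw [X_pow_eq_monomial, mom_monomial, one_mul]

lemma mom_C (u v c : ℝ) : mom u v (C c) = c := by
  rw [← monomial_zero_left, mom_monomial]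
  simp

lemma mom_eq_sum (u v : ℝ) (q : ℝ[X]) :
    mom u v q = q.sum fun p c => c * (rf u p / rf v p) := by
  rw [mom, Polynomial.lsum_apply]
  simp [mul_comm]

/-- The algebraic form of the Beta integral. In the induction step `(1 - y)^(r+1) = (1 - y)^r - y (1
- y)^r`, and the two terms combine because `(v + p + r) - (u + p) = v - u + r`. -/
lemma mom_X_pow_mul_one_sub_X_pow (u : ℝ) {v : ℝ} (hv : 0 < v) (p r : ℕ) :
    mom u v (X ^ p * (1 - X) ^ r) = rf u p * rf (v - u) r / rf v (p + r) := by
  induction r generalizing p with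
  | zero => simp [mom_X_pow]
  | succ r ih =>
    have : (X ^ p * (1 - X) ^ (r + 1) : ℝ[X])
        = X ^ p * (1 - X) ^ r - X ^ (p + 1) * (1 - X) ^ r := by ring
    rw [this, map_sub, ih, ih, rf_succ, rf_succ, ← add_assoc, add_right_comm p 1 r, rf_succ]
    have := rf_ne_zero hv (p + r)
    have : v + (p + r : ℕ) ≠ 0 := by positivity
    field_simp
    push_cast
    ring


/-! ### Jacobi polynomials in `y`: derivatives and moments. -/

/-- The coefficient of `y ^ k` in the Jacobi polynomial written in `y = (1 - x) / 2`, where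
`l = α + γ`. -/
def jacCoeff (n : ℕ) (α l : ℝ) (k : ℕ) : ℝ :=
  (-1) ^ k * n.choose k * rf (l + n + 1) k * rf (α + k + 1) (n - k) / n.factorial

/-- The Jacobi polynomial in the variable `y = (1 - x) / 2`, where `l = α + γ`. -/
def jac (n : ℕ) (α l : ℝ) : ℝ[X] := ∑ k ∈ range (n + 1), jacCoeff n α l k • X ^ k

lemma jacobiP_eq_comp (n : ℕ) (α γ : ℝ) :
    jacobiP n α γ = (jac n α (α + γ)).comp (C (1 / 2) * (1 - X)) := by
  rw [jacobiP, jac, Polynomial.sum_comp]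
  refine sum_congr rfl fun k hk => ?_
  rw [smul_comp, X_pow_comp, poch_natCast, poch_natCast_sub _ (by simpa [Nat.lt_succ_iff] using hk),
    ← neg_sub 1 X, mul_neg, neg_pow, smul_eq_C_mul, jacCoeff, ← mul_assoc]
  congr 1
  have : (-1 : ℝ[X]) ^ k = C ((-1) ^ k) := by simp
  rw [this, ← C_mul]
  congr 1
  ring

@[simp] lemma jac_zero (α l : ℝ) : jac 0 α l = 1 := by simp [jac, jacCoeff]

lemma natDegree_jac_le (n : ℕ) (α l : ℝ) : (jac n α l).natDegree ≤ n :=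
  natDegree_sum_le_of_forall_le _ _ fun k hk =>
    (natDegree_smul_le _ _).trans ((natDegree_X_pow_le k).trans (by simpa [Nat.lt_succ_iff] using hk))

lemma rf_split {α : ℝ} {n k : ℕ} (hk : k ≤ n) :
    rf (α + k + 1) (n - k) * rf (α + 1) k = rf (α + 1) n := by
  rw [mul_comm, add_right_comm, ← rf_add, Nat.add_sub_cancel' hk]

/-- Differentiation raises both exponents by one, hence `α + 1` and `l + 2`. -/
lemma derivative_jac_succ (n : ℕ) (α l : ℝ) :
    derivative (jac (n + 1) α l) = -(l + n + 2) • jac n (α + 1) (l + 2) := by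
  rw [jac, derivative_sum, sum_range_succ', jac, smul_sum]
  simp only [pow_zero, derivative_smul, derivative_one, smul_zero, add_zero, derivative_X_pow]
  refine sum_congr rfl fun k hk => ?_
  rw [smul_smul, smul_eq_C_mul, smul_eq_C_mul, ← mul_assoc, ← C_mul, Nat.add_sub_cancel]
  congr 2
  have h := Nat.add_one_mul_choose_eq n k
  have h' : ((n : ℝ) + 1) * n.choose k = (n + 1).choose (k + 1) * (k + 1) := by exact_mod_cast h
  have hf : (n.factorial : ℝ) ≠ 0 := by positivity
  have hn : (n : ℝ) + 1 ≠ 0 := by positivity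
  rw [jacCoeff, jacCoeff, rf_succ_left, Nat.factorial_succ, Nat.add_sub_add_right]
  push_cast
  have e₁ : l + (n + 1) + 1 = l + n + 2 := by ring
  have e₂ : l + (n + 1) + 1 + 1 = l + 2 + n + 1 := by ring
  have e₃ : α + (k + 1) + 1 = α + 1 + k + 1 := by ring
  rw [e₂, e₁, e₃, pow_succ]
  field_simp
  linear_combination (l + n + 2) * rf (l + 2 + n + 1) k * rf (α + 1 + k + 1) (n - k) * h'

lemma iterate_derivative_jac {n t : ℕ} (ht : t ≤ n) (α l : ℝ) :
    derivative^[t] (jac n α l)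
      = ((-1) ^ t * rf (l + n + 1) t) • jac (n - t) (α + t) (l + 2 * t) := by
  induction t with
  | zero => simp
  | succ t ih =>
    obtain ⟨k, rfl⟩ : ∃ k, n = k + 1 + t := ⟨n - t - 1, by lia⟩
    rw [Function.iterate_succ_apply', ih (by lia), derivative_smul,
      show k + 1 + t - t = k + 1 by lia, show k + 1 + t - (t + 1) = k by lia,
      derivative_jac_succ, smul_smul, rf_succ]
    push_cast
    congr 1
    · ring
    · congr 1 <;> ring

lemma iterate_derivative_jac_of_lt {n t : ℕ} (ht : n < t) (α l : ℝ) :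
    derivative^[t] (jac n α l) = 0 :=
  iterate_derivative_eq_zero ((natDegree_jac_le n α l).trans_lt ht)

/-- Moments of a Jacobi polynomial against a power of `y`, as a terminating `₃F₂`. -/
lemma mom_X_pow_mul_jac {α : ℝ} (hα : 0 < α + 1) (u v l : ℝ) (w N : ℕ) :
    mom u v (X ^ w * jac N α l) = rf u w / rf v w * (rf (α + 1) N / N.factorial) *
      hyp3F2 (-(N : ℝ)) (l + N + 1) (u + w) (α + 1) (v + w) 1 := by
  rw [hyp3F2_neg_natCast, jac, mul_sum, map_sum, mul_sum]
  refine sum_congr rfl fun i hi => ?_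
  have h := rf_split (α := α) (n := N) (k := i) (by simpa [Nat.lt_succ_iff] using hi)
  rw [mul_smul_comm, map_smul, ← pow_add, mom_X_pow, rf_add, rf_add, jacCoeff, ← h, smul_eq_mul]
  have := rf_ne_zero hα i
  rw [mul_div_mul_comm (rf u w), mul_div_mul_comm (rf (l + N + 1) i)]
  field_simp

/-- Moments of a Jacobi polynomial against its own weight and a power of `1 - y`. -/
lemma mom_one_sub_X_pow_mul_jac {l : ℝ} (hl : 0 < l + 2) (α : ℝ) (r j : ℕ) :
    mom (α + 1) (l + 2) ((1 - X) ^ r * jac j α l)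
      = rf (α + 1) j * rf (l - α + 1) r * r.descFactorial j
        / (j.factorial * rf (l + 2) (j + r)) := by
  have hr : 0 < l + 2 + r := by positivity
  have chu := chu_vandermonde j (l + j + 1) hr
  -- The Chu–Vandermonde numerator becomes a falling factorial of `r`, which vanishes for `r < j`:
  -- this is orthogonality.
  rw [show l + 2 + r - (l + j + 1) = (r : ℝ) - j + 1 by ring, rf_natCast_sub] at chu
  have : ∀ i ∈ range (j + 1), mom (α + 1) (l + 2) ((1 - X) ^ r * jacCoeff j α l i • X ^ i)
      = rf (α + 1) j * rf (l - α + 1) r / (j.factorial * rf (l + 2) r) *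
        ((-1) ^ i * j.choose i * (rf (l + j + 1) i / rf (l + 2 + r) i)) := by
    intro i hi
    have h := rf_split (α := α) (n := j) (k := i) (by simpa [Nat.lt_succ_iff] using hi)
    rw [mul_smul_comm, map_smul, mul_comm, mom_X_pow_mul_one_sub_X_pow _ hl, add_comm i r, rf_add,
      jacCoeff, ← h, show l + 2 - (α + 1) = l - α + 1 by ring, smul_eq_mul]
    have := rf_ne_zero hl r
    have := rf_ne_zero hr i
    field_simp
  rw [jac, mul_sum, map_sum, sum_congr rfl this, ← mul_sum, chu, add_comm j r, rf_add]
  have := rf_ne_zero hl r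
  have := rf_ne_zero hr j
  field_simp

/-! ### Expansion of a polynomial in Jacobi polynomials. -/

/-- The coefficient of the `k`-th Jacobi polynomial in the expansion of `Q`. -/
def expCoeff (α l : ℝ) (k : ℕ) : ℝ[X] →ₗ[ℝ] ℝ :=
  ((-1) ^ k / rf (l + k + 1) k) •
    mom (α + k + 1) (l + 2 * k + 2) ∘ₗ (derivative : ℝ[X] →ₗ[ℝ] ℝ[X]) ^ k

lemma expCoeff_apply (α l : ℝ) (k : ℕ) (Q : ℝ[X]) :
    expCoeff α l k Q = (-1) ^ k / rf (l + k + 1) k *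
      mom (α + k + 1) (l + 2 * k + 2) (derivative^[k] Q) := by
  simp [expCoeff, Module.End.pow_apply]

/-- Compatibility of the coefficients with differentiation: `-(l + k + 2)` is the factor produced by
differentiating the Jacobi polynomial of degree `k + 1`. This drives the induction on the degree in
`jac_expansion`. -/
lemma expCoeff_succ {l : ℝ} (hl : 0 < l + 2) (α : ℝ) (k : ℕ) (Q : ℝ[X]) :
    expCoeff α l (k + 1) Q * -(l + k + 2) = expCoeff (α + 1) (l + 2) k (derivative Q) := by
  have h : l + k + 2 ≠ 0 := by
    have : 0 < l + 2 + k := by positivity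
    linarith
  rw [expCoeff_apply, expCoeff_apply, Function.iterate_succ_apply, rf_succ_left]
  push_cast
  rw [show l + (k + 1) + 1 = l + k + 2 by ring, show l + k + 2 + 1 = l + 2 + k + 1 by ring,
    show α + (k + 1) + 1 = α + 1 + k + 1 by ring,
    show l + 2 * (k + 1) + 2 = l + 2 + 2 * k + 2 by ring, pow_succ]
  by_cases hr : rf (l + 2 + k + 1) k = 0
  · simp [hr]
  field_simp

/-- Every polynomial is the sum of its Jacobi expansion. -/
theorem jac_expansion {l : ℝ} (hl : 0 < l + 2) (α : ℝ) {N : ℕ} {Q : ℝ[X]} (hQ : Q.natDegree ≤ N) :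
    ∑ k ∈ range (N + 1), expCoeff α l k Q • jac k α l = Q := by
  induction N generalizing α l Q with
  | zero =>
    obtain ⟨c, rfl⟩ : ∃ c, Q = C c := ⟨_, eq_C_of_natDegree_le_zero hQ⟩
    simp [expCoeff_apply, mom_C, smul_eq_C_mul]
  | succ N ih =>
    set S := ∑ k ∈ range (N + 1 + 1), expCoeff α l k Q • jac k α l with hS
    -- The expansion and `Q` have the same derivative (induction at the raised exponents) and the
    -- same mean, so they coincide.
    have hd : derivative S = derivative Q := by
      rw [← ih (l := l + 2) (by linarith) (α + 1) (Q := derivative Q)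
        ((natDegree_derivative_le Q).trans (by lia)), hS, derivative_sum, sum_range_succ']
      simp only [derivative_smul, derivative_jac_succ, smul_smul, expCoeff_succ hl]
      simp
    have hm : mom (α + 1) (l + 2) S = mom (α + 1) (l + 2) Q := by
      have h0 : ∀ k, mom (α + 1) (l + 2) (jac (k + 1) α l) = 0 := fun k => by
        simpa using mom_one_sub_X_pow_mul_jac hl α 0 (k + 1)
      rw [hS, map_sum, sum_range_succ']
      simp only [map_smul, h0]
      have := mom_C (α + 1) (l + 2) 1
      simp_all [expCoeff_apply]
    have hc : S - Q = C ((S - Q).coeff 0) :=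
      eq_C_of_derivative_eq_zero (by rw [derivative_sub, hd, sub_self])
    have : (S - Q).coeff 0 = 0 := by
      rw [← mom_C (α + 1) (l + 2) ((S - Q).coeff 0), ← hc, map_sub, hm, sub_self]
    rwa [this, C_0, sub_eq_zero] at hc


/-! ### The printed connection and linearization coefficients are expansion coefficients. -/

/-- The factors `l + i + 1` of the Gamma quotients do not vanish at regular parameters. -/
lemma add_natCast_add_one_ne_zero {l : ℝ} (hl : 0 < l + 2) (hl' : l ≠ -1) (i : ℕ) :
    l + i + 1 ≠ 0 := by
  rcases Nat.eq_zero_or_pos i with rfl | hi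
  · simpa using fun h => hl' (by linarith)
  · have : (1 : ℝ) ≤ i := by exact_mod_cast hi
    linarith

lemma Gamma_add_natCast_add_one_ne_zero {l : ℝ} (hl : 0 < l + 2) (hl' : l ≠ -1) (i : ℕ) :
    Real.Gamma (l + i + 1) ≠ 0 := Real.Gamma_ne_zero fun k h => by
  have := add_natCast_add_one_ne_zero hl hl' (i + k)
  push_cast at this
  exact this (by linarith)

lemma Gamma_add_two_mul_add_one {l : ℝ} (hl : 0 < l + 2) (hl' : l ≠ -1) (i : ℕ) :
    Real.Gamma (l + 2 * i + 1) = rf (l + i + 1) i * Real.Gamma (l + i + 1) := by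
  rw [← Gamma_add_natCast (fun k _ => ?_), show l + 2 * i + 1 = l + i + 1 + (i : ℝ) by ring]
  have := add_natCast_add_one_ne_zero hl hl' (i + k)
  push_cast at this
  rwa [add_right_comm, add_assoc l]

/-- The connection coefficients expand a Jacobi polynomial in those with other parameters. -/
lemma connCoeff_eq_expCoeff {α γ β : ℝ} (hα : 0 < α + 1) (hσ : 0 < β * (α + γ) + 2)
    (hσ' : β * (α + γ) ≠ -1) {k j : ℕ} (hj : j ≤ k) :
    connCoeff k j α γ β = expCoeff (α * β) (β * (α + γ)) j (jac k α (α + γ)) := by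
  obtain ⟨N, rfl⟩ := Nat.exists_eq_add_of_le' hj
  have hαj : 0 < α + j + 1 := by
    have : 0 < α + 1 + j := by positivity
    linarith
  rw [expCoeff_apply, iterate_derivative_jac hj, map_smul,
    ← one_mul (jac _ _ _), ← pow_zero (X : ℝ[X]), mom_X_pow_mul_jac hαj, connCoeff,
    poch_natCast, poch_natCast_sub _ hj, Nat.add_sub_cancel]
  set σ := β * (α + γ)
  push_cast
  have hH : hyp3F2 (-((N : ℝ) + j) + j) (α + γ + (N + j) + j + 1) (α * β + j + 1)
      (α + j + 1) (σ + 2 * j + 2) 1 = hyp3F2 (-(N : ℝ)) (α + γ + 2 * j + N + 1)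
      (α * β + j + 1 + 0) (α + j + 1) (σ + 2 * j + 2 + 0) 1 := by
    congr 1 <;> ring
  have hΓ := Gamma_add_natCast_add_one_ne_zero hσ hσ' j
  have h := add_natCast_add_one_ne_zero hσ hσ' (2 * j)
  push_cast at h
  have h2 : Real.Gamma (σ + 2 * j + 2)
      = (σ + 2 * j + 1) * (rf (σ + j + 1) j * Real.Gamma (σ + j + 1)) := by
    rw [← Gamma_add_two_mul_add_one hσ hσ', ← Real.Gamma_add_one h]
    congr 1
    ring
  -- Otherwise the factorization of `Γ(σ + 2j + 2)` would make this positive value zero.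
  have hr : rf (σ + j + 1) j ≠ 0 := by
    intro h
    rw [h, zero_mul, mul_zero] at h2
    have : 0 < σ + 2 + 2 * j := by positivity
    exact (Real.Gamma_pos_of_pos (by linarith : 0 < σ + 2 * j + 2)).ne' h2
  rw [hH, h2]
  simp only [rf_zero, smul_eq_mul]
  have hs : ((-1 : ℝ) ^ j) ^ 2 = 1 := by rw [← pow_mul, mul_comm, pow_mul]; simp
  rw [show α + γ + ((N : ℝ) + j) + 1 = α + γ + N + j + 1 by ring]
  generalize σ + 2 * j + 1 = D at *
  generalize hyp3F2 _ _ _ _ _ _ = H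
  field_simp
  rw [hs, mul_one]

/-- A product of two shifted Jacobi polynomials against a shifted weight. -/
lemma mom_jac_mul_jac {α : ℝ} (hα : 0 < α + 1) (u v l α' l' : ℝ) (N M : ℕ) :
    mom u v (jac N α l * jac M α' l') = ∑ w ∈ range (M + 1), jacCoeff M α' l' w *
      (rf u w / rf v w * (rf (α + 1) N / N.factorial) *
        hyp3F2 (-(N : ℝ)) (l + N + 1) (u + w) (α + 1) (v + w) 1) := by
  conv_lhs => rw [mul_comm, jac.eq_def M, sum_mul, map_sum]
  refine sum_congr rfl fun w _ => ?_
  rw [smul_mul_assoc, map_smul, mom_X_pow_mul_jac hα, smul_eq_mul]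

/-- Trades the printed binomials for the Leibniz binomial and the factorials that normalize the
differentiated Jacobi polynomials. -/
lemma choose_mul_choose_identity {n m t q : ℕ} (ht : t ≤ n) (hq : q ≤ m) :
    ((t + q).factorial : ℝ) * (n.choose t * m.choose q) / (n.factorial * m.factorial)
      = (t + q).choose t / ((n - t).factorial * (m - q).factorial) := by
  rw [Nat.cast_choose ℝ ht, Nat.cast_choose ℝ hq, Nat.cast_choose ℝ (Nat.le_add_right t q),
    Nat.add_sub_cancel_left]
  have (i : ℕ) : (i.factorial : ℝ) ≠ 0 := by positivity
  field_simp [this]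

/-- One term of the linearization coefficient, with `k = t + q`, `n = N + t`, `m = M + q`. -/
lemma linCoeff_term (N M t q w : ℕ) (hw : w ≤ M) {α l : ℝ} (hα : 0 < α + 1) (hl : 0 < l + 2)
    (H A B₁ B₂ : ℝ) :
    ((t + q).factorial : ℝ) / ((N + t).factorial * (M + q).factorial)
        * rf (l + (N + t : ℕ) + 1) (N + t) * rf (l + (M + q : ℕ) + 1) (M + q)
      * (((N + t).choose t * (M + q).choose q) * (A / rf (l + (N + t : ℕ) + t + 1) N) *
        (M.choose w * ((-1) ^ w * (rf (l + 2 * (M + q : ℕ) + 1 - (M - w : ℕ)) (M - w))⁻¹ * B₁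
          / ((rf (α + (M + q : ℕ) + 1 - (M - w : ℕ)) (M - w))⁻¹ * B₂)) * H))
      = (t + q).choose t * (rf (l + (N + t : ℕ) + 1) t * rf (l + (M + q : ℕ) + 1) q)
        * (jacCoeff M (α + q) (l + 2 * q) w * (B₁ / B₂ * (A / N.factorial) * H)) := by
  have hc := choose_mul_choose_identity (n := N + t) (m := M + q) (t := t) (q := q)
    (by lia) (by lia)
  rw [Nat.add_sub_cancel, Nat.add_sub_cancel] at hc
  obtain ⟨P, rfl⟩ := Nat.exists_eq_add_of_le' hw
  rw [Nat.add_sub_cancel, jacCoeff, Nat.add_sub_cancel]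
  push_cast at hc ⊢
  have e₁ : l + 2 * ((P : ℝ) + w + q) + 1 - P = l + (P + w + q) + 1 + q + w := by ring
  have e₂ : α + ((P : ℝ) + w + q) + 1 - P = α + q + w + 1 := by ring
  have e₃ : l + 2 * (q : ℝ) + (P + w) + 1 = l + (P + w + q) + 1 + q := by ring
  have e₄ : l + (N + (t : ℝ)) + t + 1 = l + (N + t) + 1 + t := by ring
  -- In both splittings the first factor comes from differentiation and the last cancels a printed
  -- Pochhammer symbol; the middle factor of `s₂` belongs to `jacCoeff`.
  have s₁ : rf (l + (N + (t : ℝ)) + 1) (N + t)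
      = rf (l + (N + t) + 1) t * rf (l + (N + t) + 1 + t) N := by rw [add_comm N t, rf_add]
  have s₂ : rf (l + ((P : ℝ) + w + q) + 1) (P + w + q)
      = rf (l + (P + w + q) + 1) q * rf (l + (P + w + q) + 1 + q) w
        * rf (l + (P + w + q) + 1 + q + w) P := by
    rw [show P + w + q = q + w + P by ring, rf_add, rf_add, Nat.cast_add, add_assoc _ (q : ℝ)]
  rw [e₁, e₂, e₃, e₄, s₁, s₂]
  have n₁ : rf (l + (N + (t : ℝ)) + 1 + t) N ≠ 0 := by
    -- With `N = 0` and `t = 0` the base is `l + 1`, possibly nonpositive, but the product is then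
    -- empty.
    cases N with
    | zero => simp
    | succ N =>
      refine rf_ne_zero ?_ _
      have : 0 < l + 2 + (N + t + t) := by positivity
      push_cast
      linarith
  have n₂ : rf (l + ((P : ℝ) + w + q) + 1 + q + w) P ≠ 0 := by
    cases P with
    | zero => simp
    | succ P =>
      refine rf_ne_zero ?_ _
      have : 0 < l + 2 + (P + w + q + q + w) := by positivity
      push_cast
      linarith
  have n₃ : rf (α + (q : ℝ) + w + 1) P ≠ 0 := by
    refine rf_ne_zero ?_ _
    have : 0 < α + 1 + (q + w) := by positivity
    linarith
  generalize rf (l + (N + (t : ℝ)) + 1) t = R₁ at *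
  generalize rf (l + (N + (t : ℝ)) + 1 + t) N = R₂ at *
  generalize rf (l + ((P : ℝ) + w + q) + 1) q = R₃ at *
  generalize rf (l + ((P : ℝ) + w + q) + 1 + q) w = R₄ at *
  generalize rf (l + ((P : ℝ) + w + q) + 1 + q + w) P = R₅ at *
  generalize rf (α + (q : ℝ) + w + 1) P = R₆ at *
  generalize ((t + q).factorial : ℝ) = f₀ at *
  generalize ((N + t).factorial : ℝ) = f₁ at *
  generalize ((P + w + q).factorial : ℝ) = f₂ at *
  generalize ((P + w).factorial : ℝ) = f₃ at *
  generalize (N.factorial : ℝ) = f₄ at *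
  generalize ((N + t).choose t : ℝ) = c₁ at *
  generalize ((P + w + q).choose q : ℝ) = c₂ at *
  generalize ((P + w).choose w : ℝ) = c₃ at *
  generalize ((t + q).choose t : ℝ) = c₄ at *
  generalize (-1 : ℝ) ^ w = S at *
  calc _ = f₀ * (c₁ * c₂) / (f₁ * f₂) * (R₁ * R₃ * R₄ * R₆ * A * S * c₃ * B₁ * B₂⁻¹ * H)
        * (R₂ * R₂⁻¹) * (R₅ * R₅⁻¹) := by
        simp only [div_eq_mul_inv, mul_inv, inv_inv]
        ring
    _ = _ := by
      rw [hc, mul_inv_cancel₀ n₁, mul_inv_cancel₀ n₂]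
      ring

/-- The linearization coefficients expand the product of two Jacobi polynomials. -/
lemma linCoeff_eq_expCoeff {α γ : ℝ} (hα : 0 < α + 1) (hl : 0 < α + γ + 2) (hl' : α + γ ≠ -1)
    {n m k : ℕ} :
    linCoeff n m k α γ
      = expCoeff α (α + γ) k (jac n α (α + γ) * jac m α (α + γ)) := by
  set l := α + γ with hldef
  have hΓ := Gamma_add_natCast_add_one_ne_zero hl hl'
  have h2 := Gamma_add_two_mul_add_one hl hl'
  have hαi : ∀ i : ℕ, 0 < α + i + 1 := fun i => by
    have : 0 < α + 1 + i := by positivity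
    linarith
  have hsign : (-1 : ℝ) ^ k * (-1) ^ k = 1 := by rw [← mul_pow]; simp
  have pre : (k.factorial * Real.Gamma (l + k + 1) * Real.Gamma (l + 2 * n + 1)
      * Real.Gamma (l + 2 * m + 1))
    / (n.factorial * m.factorial * Real.Gamma (l + 2 * k + 1) * Real.Gamma (l + n + 1)
      * Real.Gamma (l + m + 1)) = 1 / rf (l + k + 1) k *
        ((k.factorial : ℝ) / (n.factorial * m.factorial)
        * rf (l + n + 1) n * rf (l + m + 1) m) := by
    rw [h2, h2, h2]
    have := hΓ k
    have := hΓ n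
    have := hΓ m
    field_simp
  -- The swap makes the Leibniz index `t` count the derivatives falling on `P_n`, as in the printed
  -- sum.
  rw [linCoeff, ← hldef, pre, expCoeff_apply, mul_comm (jac n α l), iterate_derivative_mul,
    map_sum, mul_assoc, mul_sum, mul_sum, mul_sum]
  have hsub : Icc (k - m) (min k n) ⊆ range k.succ := fun t ht => by
    simp only [mem_Icc, le_min_iff] at ht
    simp only [mem_range]
    lia
  -- Outside the printed range of `t` one of the two factors is differentiated more often than its
  -- degree.
  rw [← sum_subset hsub]
  · refine sum_congr rfl fun t ht => ?_
    simp only [mem_Icc, le_min_iff] at ht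
    obtain ⟨q, rfl⟩ := Nat.exists_eq_add_of_le ht.2.1
    obtain ⟨N, rfl⟩ := Nat.exists_eq_add_of_le' ht.2.2
    obtain ⟨M, rfl⟩ := Nat.exists_eq_add_of_le' (show q ≤ m by lia)
    rw [show t + q - t = q by lia,
      mul_comm (derivative^[q] _), iterate_derivative_jac (by lia), iterate_derivative_jac (by lia),
      smul_mul_smul_comm, map_nsmul, map_smul, Nat.add_sub_cancel, Nat.add_sub_cancel, mom_jac_mul_jac (hαi t),
      show M + q + t - (t + q) = M by lia, mul_sum, mul_sum, mul_sum, smul_sum,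
      smul_sum, mul_sum]
    refine sum_congr rfl fun w hw => ?_
    have hw : w ≤ M := by simpa [Nat.lt_succ_iff] using hw
    -- The integer Pochhammer index is never positive, so both symbols are reciprocals of rising
    -- factorials.
    have hidx : ((t + q : ℕ) : ℤ) + w - (M + q : ℕ) - t = -((M - w : ℕ) : ℤ) := by lia
    rw [hidx, poch_neg_natCast, poch_neg_natCast, poch_natCast, poch_natCast,
      poch_natCast_sub _ (Nat.le_add_left t N), poch_natCast_sub _ (Nat.le_add_left t N),
      Nat.add_sub_cancel]
    have hH : hyp3F2 (t - (N + t : ℕ)) (l + (N + t : ℕ) + t + 1) (α + (t + q : ℕ) + w + 1)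
        (α + t + 1) (l + 2 * (t + q : ℕ) + w + 2) 1
        = hyp3F2 (-N) (l + 2 * t + N + 1) (α + (t + q : ℕ) + 1 + w) (α + t + 1)
          (l + 2 * (t + q : ℕ) + 2 + w) 1 := by
      congr 1 <;> push_cast <;> ring
    rw [hH]
    generalize hyp3F2 _ _ _ _ _ _ = H
    rw [linCoeff_term N M t q w hw hα hl, nsmul_eq_mul, smul_eq_mul]
    generalize jacCoeff _ _ _ _ * _ = Z
    generalize ((t + q).choose t : ℝ) = c
    generalize rf (l + (N + t : ℕ) + 1) t = R₁
    generalize rf (l + (M + q : ℕ) + 1) q = R₂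
    rw [div_mul_eq_mul_div, div_mul_eq_mul_div]
    congr 1
    linear_combination (-c * R₁ * R₂ * Z) * hsign
      + (c * R₁ * R₂ * Z) * (-1) ^ (t + q) * (pow_add (-1 : ℝ) t q)
  · intro t ht ht'
    simp only [mem_Icc, le_min_iff, mem_range, not_and_or] at ht ht'
    by_cases htn : n < t
    · rw [iterate_derivative_jac_of_lt htn]
      simp
    · rw [iterate_derivative_jac_of_lt (n := m) (t := k - t) (by lia)]
      simp


/-! ### Orthogonality; the linearization and connection formulas. -/

/-- A Jacobi polynomial is orthogonal to all polynomials of smaller degree. -/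
lemma mom_mul_jac_eq_zero {l : ℝ} (hl : 0 < l + 2) (α : ℝ) {n : ℕ} {Q : ℝ[X]}
    (hQ : Q.natDegree < n) : mom (α + 1) (l + 2) (Q * jac n α l) = 0 := by
  have hd : (Q.comp (1 - X)).natDegree < n := by
    have h : (1 - X : ℝ[X]).natDegree ≤ 1 := by compute_degree
    exact (natDegree_comp_le.trans (Nat.mul_le_mul_left _ h)).trans_lt (by simpa using hQ)
  -- Powers of `1 - y` are used because their moments against a Jacobi polynomial are explicit.
  have hQ' : Q = ∑ i ∈ range n, (Q.comp (1 - X)).coeff i • (1 - X) ^ i := by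
    conv_lhs => rw [show Q = (Q.comp (1 - X)).comp (1 - X) by simp [comp_assoc]]
    conv_lhs => rw [as_sum_range' _ n hd]
    simp [Polynomial.sum_comp, smul_eq_C_mul]
  rw [hQ', sum_mul, map_sum]
  refine sum_eq_zero fun i hi => ?_
  rw [smul_mul_assoc, map_smul, mom_one_sub_X_pow_mul_jac hl,
    Nat.descFactorial_eq_zero_iff_lt.2 (by simpa using hi)]
  simp

/-- The expansion of a product of Jacobi polynomials starts at the difference of the degrees. -/
lemma expCoeff_jac_mul_jac_eq_zero {α l : ℝ} (hα : 0 < α + 1) (hγ : 0 < l - α + 1) {n m k : ℕ}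
    (hk : k + m < n) : expCoeff α l k (jac n α l * jac m α l) = 0 := by
  have hl : 0 < l + 2 := by linarith
  induction k using Nat.strong_induction_on with
  | _ k ih =>
    have h0 : mom (α + 1) (l + 2) ((1 - X) ^ k * (jac n α l * jac m α l)) = 0 := by
      rw [mul_left_comm, mul_comm (jac n α l)]
      refine mom_mul_jac_eq_zero hl α (lt_of_le_of_lt ?_ hk)
      refine natDegree_mul_le.trans (add_le_add ?_ (natDegree_jac_le m α l))
      have h : (1 - X : ℝ[X]).natDegree ≤ 1 := by compute_degree
      simpa using natDegree_pow_le.trans (Nat.mul_le_mul_left k h)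
    have hdeg : (jac n α l * jac m α l).natDegree ≤ n + m :=
      natDegree_mul_le.trans (add_le_add (natDegree_jac_le n α l) (natDegree_jac_le m α l))
    -- Testing the expansion against `(1 - y)^k` is triangular: terms below `k` vanish by induction,
    -- terms above by orthogonality, and the diagonal moment is nonzero.
    rw [← jac_expansion hl α hdeg, mul_sum, map_sum, sum_eq_single k] at h0
    · rw [mul_smul_comm, map_smul, mom_one_sub_X_pow_mul_jac hl, Nat.descFactorial_self,
        smul_eq_mul, mul_eq_zero] at h0
      refine h0.resolve_right ?_
      have := rf_ne_zero hα k
      have := rf_ne_zero hγ k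
      have := rf_ne_zero hl (k + k)
      positivity
    · intro i _ hik
      rw [mul_smul_comm, map_smul]
      rcases lt_or_gt_of_ne hik with h | h
      · rw [ih i h (by lia), zero_smul]
      · rw [mom_one_sub_X_pow_mul_jac hl, Nat.descFactorial_eq_zero_iff_lt.2 h]
        simp
    · intro h
      simp at h
      lia

/-- The linearization formula for Jacobi polynomials. -/
theorem jac_mul_jac {α γ : ℝ} (hα : -1 < α) (hγ : -1 < γ) (hl : α + γ ≠ -1) (n m : ℕ) :
    jac n α (α + γ) * jac m α (α + γ)
      = ∑ k ∈ Icc ((n : ℤ) - m).natAbs (n + m), linCoeff n m k α γ • jac k α (α + γ) := by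
  have hα' : 0 < α + 1 := by linarith
  have hl2 : 0 < α + γ + 2 := by linarith
  have hγ' : 0 < α + γ - α + 1 := by linarith
  have hdeg : (jac n α (α + γ) * jac m α (α + γ)).natDegree ≤ n + m :=
    natDegree_mul_le.trans (add_le_add (natDegree_jac_le n _ _) (natDegree_jac_le m _ _))
  conv_lhs => rw [← jac_expansion hl2 α hdeg]
  have hsub : Icc ((n : ℤ) - m).natAbs (n + m) ⊆ range (n + m + 1) := fun k hk => by
    simp only [mem_Icc, mem_range] at hk ⊢
    lia
  rw [← sum_subset hsub]
  · exact sum_congr rfl fun k _ => by rw [linCoeff_eq_expCoeff hα' hl2 hl]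
  · intro k hk hk'
    simp only [mem_Icc, mem_range] at hk hk'
    rcases le_total m n with h | h
    · rw [expCoeff_jac_mul_jac_eq_zero hα' hγ' (by lia), zero_smul]
    · rw [mul_comm, expCoeff_jac_mul_jac_eq_zero hα' hγ' (by lia), zero_smul]

/-- The connection formula for Jacobi polynomials. -/
theorem jac_connection {α γ β : ℝ} (hα : -1 < α) (hσ : 0 < β * (α + γ) + 2)
    (hσ' : β * (α + γ) ≠ -1) (k : ℕ) :
    jac k α (α + γ) = ∑ j ∈ range (k + 1),
      connCoeff k j α γ β • jac j (α * β) (β * (α + γ)) := by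
  conv_lhs => rw [← jac_expansion hσ (α * β) (natDegree_jac_le k α (α + γ))]
  refine sum_congr rfl fun j hj => ?_
  rw [connCoeff_eq_expCoeff (by linarith) hσ hσ' (by simpa [Nat.lt_succ_iff] using hj)]

/-! ### Inversion coefficients, and the triple sum as one moment. -/

/-- The moment of `x ^ s = (1 - 2 y) ^ s` against a Jacobi polynomial. -/
lemma mom_one_sub_two_X_pow_mul_jac {l : ℝ} (hl : 0 < l + 2) (α : ℝ) (s j : ℕ) :
    mom (α + 1) (l + 2) ((1 - 2 * X) ^ s * jac j α l)
      = (-1) ^ ((s : ℤ) - j) * s.choose j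
        * ordinaryHypergeometric ((j : ℝ) - s) (l - α + j + 1) (l + 2 * j + 2) (2 : ℝ)
        * (2 ^ j * rf (α + 1) j * rf (l - α + 1) j / rf (l + 2) (2 * j)) := by
  have hx : (1 - 2 * X : ℝ[X]) ^ s
      = ∑ r ∈ range (s + 1), (2 ^ r * (-1) ^ (s - r) * s.choose r : ℝ) • (1 - X) ^ r := by
    rw [show (1 - 2 * X : ℝ[X]) = 2 * (1 - X) + -1 by ring, add_pow]
    refine sum_congr rfl fun r _ => ?_
    rw [mul_pow, smul_eq_C_mul]
    simp only [C_mul, C_pow, C_neg, C_1, map_natCast, show C (2 : ℝ) = 2 from rfl]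
    ring
  have hterm : mom (α + 1) (l + 2) ((1 - 2 * X) ^ s * jac j α l)
      = ∑ r ∈ range (s + 1), (2 ^ r * (-1) ^ (s - r) * s.choose r) *
        (rf (α + 1) j * rf (l - α + 1) r * r.descFactorial j
        / (j.factorial * rf (l + 2) (j + r))) := by
    rw [hx, sum_mul, map_sum]
    refine sum_congr rfl fun r _ => ?_
    rw [smul_mul_assoc, map_smul, mom_one_sub_X_pow_mul_jac hl, smul_eq_mul]
  rw [hterm]
  rcases lt_or_ge s j with hsj | hjs
  · rw [Nat.choose_eq_zero_of_lt hsj]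
    simp only [Nat.cast_zero, mul_zero, zero_mul]
    refine sum_eq_zero fun r hr => ?_
    rw [mem_range] at hr
    rw [Nat.descFactorial_eq_zero_iff_lt.2 (by lia)]
    simp
  obtain ⟨N, rfl⟩ := Nat.exists_eq_add_of_le hjs
  -- Terms with `r < j` vanish; writing `r = j + i` leaves a `₂F₁` at `2`, the power `2^i` coming
  -- from `x = 2 (1 - y) - 1`.
  rw [add_assoc j N 1, sum_range_add, sum_eq_zero (s := range j), zero_add,
    show (j : ℝ) - (j + N : ℕ) = -(N : ℝ) by push_cast; ring, ordinaryHypergeometric_neg_natCast,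
    mul_sum, sum_mul]
  · refine sum_congr rfl fun i hi => ?_
    have hi : i ≤ N := by simpa [Nat.lt_succ_iff] using hi
    obtain ⟨q, rfl⟩ := Nat.exists_eq_add_of_le hi
    have hc : ((j + (i + q)).choose (j + i) : ℝ) * (j + i).descFactorial j
        = j.factorial * ((j + (i + q)).choose j * (i + q).choose i) := by
      rw [Nat.descFactorial_eq_factorial_mul_choose]
      have := Nat.choose_mul (n := j + (i + q)) (k := j + i) (s := j) (by lia)
      rw [show j + (i + q) - j = i + q by lia, Nat.add_sub_cancel_left] at this
      rw [Nat.cast_mul, mul_left_comm]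
      exact_mod_cast congrArg _ this
    have hs : (-1 : ℝ) ^ (((j + (i + q) : ℕ) : ℤ) - j) * (-1) ^ i = (-1) ^ q := by
      rw [show ((j + (i + q) : ℕ) : ℤ) - j = ((i + q : ℕ) : ℤ) by push_cast; ring, zpow_natCast,
        pow_add, mul_right_comm, ← mul_pow]
      simp
    rw [show j + (i + q) - (j + i) = q by lia, show j + (j + i) = 2 * j + i by ring,
      rf_add (l + 2), rf_add (l - α + 1), pow_add, ← hs]
    push_cast
    rw [show l - α + 1 + j = l - α + j + 1 by ring, show l + 2 + 2 * (j : ℝ) = l + 2 * j + 2 by ring]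
    have hf : (j.factorial : ℝ) ≠ 0 := by positivity
    generalize (-1 : ℝ) ^ (_ : ℤ) = Z
    have h1 := rf_ne_zero hl (2 * j)
    have h2 := rf_ne_zero (show 0 < l + 2 * j + 2 by
      have : 0 < l + 2 + 2 * j := by positivity
      linarith) i
    generalize rf (l + 2 * j + 2) i = R at *
    field_simp
    linear_combination rf (l - α + j + 1) i * Z * rf (α + 1) j * rf (l - α + 1) j * hc
  · intro r hr
    rw [Nat.descFactorial_eq_zero_iff_lt.2 (by simpa using hr)]
    simp

/-- The total mass of the weight `(1 - x) ^ a (1 + x) ^ b` on `(-1, 1)`. -/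
def weightMass (a b : ℝ) : ℝ :=
  2 ^ (a + b + 1) * (Real.Gamma (a + 1) * Real.Gamma (b + 1) / Real.Gamma (a + b + 2))

/-- The factors `Γ(σ + j + 1)`, with `σ = β(α + γ)`, cancel between the two coefficients, and `(σ +
2j + 1) Γ(σ + 2j + 1) = (σ + 2)_{2j} Γ(σ + 2)` leaves the total mass. -/
lemma invCoeff_mul_jacobiNorm {α γ β : ℝ} (ha : -1 < α * β) (hb : -1 < β * γ)
    (hσ' : β * (α + γ) ≠ -1) (j s : ℕ) :
    invCoeff j s α γ β * jacobiNorm j α γ β = weightMass (α * β) (β * γ) *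
      mom (α * β + 1) (β * (α + γ) + 2)
        ((1 - 2 * X) ^ s * jac j (α * β) (β * (α + γ))) := by
  have hσ : β * (α + γ) = α * β + β * γ := by ring
  rw [mom_one_sub_two_X_pow_mul_jac (by linarith), invCoeff, jacobiNorm, weightMass, ← hσ,
    show β * (α + γ) - α * β = β * γ by ring]
  set σ := β * (α + γ)
  have hσ2 : 0 < σ + 2 := by linarith
  have hΓ := Gamma_add_natCast_add_one_ne_zero hσ2 hσ' j
  have hD := add_natCast_add_one_ne_zero hσ2 hσ' (2 * j)
  push_cast at hD
  have h2 : (σ + 2 * j + 1) * Real.Gamma (σ + 2 * j + 1)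
      = rf (σ + 2) (2 * j) * Real.Gamma (σ + 2) := by
    rw [← Real.Gamma_add_one hD, ← Gamma_add_natCast_of_pos hσ2]
    push_cast
    congr 1
    ring
  have hΓ2 := (Real.Gamma_pos_of_pos hσ2).ne'
  have hr := rf_ne_zero hσ2 (2 * j)
  have hΓ1 : Real.Gamma (σ + 2 * j + 1) ≠ 0 := fun h => by
    rw [h, mul_zero] at h2
    exact mul_ne_zero hr hΓ2 h2.symm
  rw [show (j : ℝ) + α * β + 1 = α * β + 1 + j by ring,
    show (j : ℝ) + β * γ + 1 = β * γ + 1 + j by ring,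
    Gamma_add_natCast_of_pos (by linarith), Gamma_add_natCast_of_pos (by linarith)]
  generalize ordinaryHypergeometric (_ : ℝ) _ _ (_ : ℝ) = H
  generalize (-1 : ℝ) ^ (_ : ℤ) = Z
  have hf : (j.factorial : ℝ) ≠ 0 := by positivity
  generalize σ + 2 * j + 1 = D at *
  generalize Real.Gamma D = G at *
  generalize (2 : ℝ) ^ (σ + 1) = T
  field_simp
  linear_combination (-(Z * s.choose j * H * T * rf (α * β + 1) j * Real.Gamma (α * β + 1)
    * rf (β * γ + 1) j * Real.Gamma (β * γ + 1))) * h2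

/-- The triple sum is the moment of `x ^ s P_m P_n`. -/
theorem kreinSum_eq_mom {α γ β : ℝ} (hα : -1 < α) (hγ : -1 < γ) (ha : -1 < α * β)
    (hb : -1 < β * γ) (hl : α + γ ≠ -1) (hσ' : β * (α + γ) ≠ -1) (m n s : ℕ) :
    kreinSum m n s α γ β = weightMass (α * β) (β * γ) *
      mom (α * β + 1) (β * (α + γ) + 2)
        ((1 - 2 * X) ^ s * (jac n α (α + γ) * jac m α (α + γ))) := by
  have hσ : 0 < β * (α + γ) + 2 := by linarith
  rw [kreinSum, jac_mul_jac hα hγ hl, mul_sum, map_sum, mul_sum]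
  refine sum_congr rfl fun k _ => ?_
  rw [mul_smul_comm, map_smul, smul_eq_mul, mul_left_comm]
  congr 1
  rw [jac_connection hα hσ hσ' k, mul_sum, map_sum, mul_sum]
  refine sum_congr rfl fun j _ => ?_
  rw [mul_assoc, invCoeff_mul_jacobiNorm ha hb hσ', mul_smul_comm, map_smul, smul_eq_mul]
  ring

open MeasureTheory Set


/-! ### Integrals against the Jacobi weight. -/

/-- The Beta integral of a real polynomial. -/
lemma beta_integral {a b : ℝ} (ha : -1 < a) (hb : -1 < b) :
    IntervalIntegrable (fun y : ℝ => y ^ a * (1 - y) ^ b) volume 0 1 ∧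
    ∫ y in (0 : ℝ)..1, y ^ a * (1 - y) ^ b
      = Real.Gamma (a + 1) * Real.Gamma (b + 1) / Real.Gamma (a + b + 2) := by
  have hu : 0 < ((a + 1 : ℝ) : ℂ).re := by simp; linarith
  have hv : 0 < ((b + 1 : ℝ) : ℂ).re := by simp; linarith
  have hcongr : EqOn (fun x : ℝ => (x : ℂ) ^ (((a + 1 : ℝ) : ℂ) - 1)
      * (1 - (x : ℂ)) ^ (((b + 1 : ℝ) : ℂ) - 1)) (fun y => ((y ^ a * (1 - y) ^ b : ℝ) : ℂ))
      (uIcc 0 1) := by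
    intro y hy
    rw [Set.uIcc_of_le zero_le_one] at hy
    simp only [Complex.ofReal_mul]
    rw [Complex.ofReal_cpow hy.1, Complex.ofReal_cpow (sub_nonneg.2 hy.2)]
    push_cast
    simp
  constructor
  · have h := (Complex.betaIntegral_convergent hu hv).congr
      (hcongr.mono uIoc_subset_uIcc)
    rw [intervalIntegrable_iff] at h ⊢
    have hre := Integrable.re h
    simp only [RCLike.re_to_complex, Complex.ofReal_re] at hre
    exact hre
  · have h := Complex.betaIntegral_eq_Gamma_mul_div _ _ hu hv
    rw [Complex.betaIntegral, intervalIntegral.integral_congr hcongr,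
      intervalIntegral.integral_ofReal, ← Complex.ofReal_add, Complex.Gamma_ofReal,
      Complex.Gamma_ofReal, Complex.Gamma_ofReal] at h
    rw [show a + b + 2 = a + 1 + (b + 1) by ring]
    exact_mod_cast h

/-- The link between analysis and `mom`: multiplying the weight by `y^p` shifts `a` to `a + p`, and
the Gamma quotient changes by the `p`-th moment. -/
lemma beta_integral_polynomial {a b : ℝ} (ha : -1 < a) (hb : -1 < b) (Q : ℝ[X]) :
    IntervalIntegrable (fun y : ℝ => y ^ a * (1 - y) ^ b * Q.eval y) volume 0 1 ∧
    ∫ y in (0 : ℝ)..1, y ^ a * (1 - y) ^ b * Q.eval y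
      = Real.Gamma (a + 1) * Real.Gamma (b + 1) / Real.Gamma (a + b + 2)
        * mom (a + 1) (a + b + 2) Q := by
  induction Q using Polynomial.induction_on' with
  | add p q hp hq =>
    simp only [eval_add, mul_add, map_add]
    exact ⟨hp.1.add hq.1, by rw [intervalIntegral.integral_add hp.1 hq.1, hp.2, hq.2]⟩
  | monomial p c =>
    have hap : -1 < a + p := by
      have : (0 : ℝ) ≤ p := p.cast_nonneg
      linarith
    have h := beta_integral hap hb
    have hcongr : EqOn (fun y : ℝ => c * (y ^ (a + p) * (1 - y) ^ b))
        (fun y => y ^ a * (1 - y) ^ b * (monomial p c).eval y) (uIoc 0 1) := by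
      intro y hy
      rw [uIoc_of_le zero_le_one] at hy
      simp only [eval_monomial, Real.rpow_add hy.1, Real.rpow_natCast]
      ring
    refine ⟨(h.1.const_mul c).congr hcongr, ?_⟩
    rw [← intervalIntegral.integral_congr_ae (Filter.Eventually.of_forall hcongr),
      intervalIntegral.integral_const_mul, h.2, mom_monomial,
      show a + p + 1 = a + 1 + p by ring, show a + p + b + 2 = a + b + 2 + p by ring,
      Gamma_add_natCast_of_pos (by linarith), Gamma_add_natCast_of_pos (by linarith),
      mul_div_mul_comm]
    have := (Real.Gamma_pos_of_pos (by linarith : 0 < a + b + 2)).ne'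
    have := rf_ne_zero (by linarith : 0 < a + b + 2) p
    field_simp

/-- The integral of a polynomial in `y = (1 - x) / 2` against the Jacobi weight. -/
lemma jacobi_integral_polynomial {a b : ℝ} (ha : -1 < a) (hb : -1 < b) (Q : ℝ[X]) :
    IntervalIntegrable (fun x : ℝ => (1 - x) ^ a * (1 + x) ^ b * Q.eval (1 / 2 - 1 / 2 * x))
      volume (-1) 1 ∧
    ∫ x in (-1 : ℝ)..1, (1 - x) ^ a * (1 + x) ^ b * Q.eval (1 / 2 - 1 / 2 * x)
      = weightMass a b * mom (a + 1) (a + b + 2) Q := by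
  -- `2^(a + b)` comes from `1 - x = 2y` and `1 + x = 2(1 - y)`; the Jacobian supplies the remaining
  -- factor 2 of the mass.
  set F : ℝ → ℝ := fun y => 2 ^ (a + b) * (y ^ a * (1 - y) ^ b * Q.eval y)
  obtain ⟨hi, hI⟩ := beta_integral_polynomial ha hb Q
  have hF : IntervalIntegrable F volume 0 1 := hi.const_mul _
  have hcongr : EqOn (fun x => F (1 / 2 - 1 / 2 * x))
      (fun x : ℝ => (1 - x) ^ a * (1 + x) ^ b * Q.eval (1 / 2 - 1 / 2 * x)) (uIcc (-1) 1) := by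
    intro x hx
    rw [Set.uIcc_of_le (by norm_num : (-1 : ℝ) ≤ 1)] at hx
    have h1 : 1 - x = 2 * (1 / 2 - 1 / 2 * x) := by ring
    have h2 : 1 + x = 2 * (1 - (1 / 2 - 1 / 2 * x)) := by ring
    have h3 : 0 ≤ 1 / 2 - 1 / 2 * x := by linarith [hx.2]
    have h4 : 0 ≤ 1 - (1 / 2 - 1 / 2 * x) := by linarith [hx.1]
    simp only [F]
    rw [h1, h2, Real.mul_rpow zero_le_two h3, Real.mul_rpow zero_le_two h4,
      Real.rpow_add zero_lt_two]
    ring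
  constructor
  · refine IntervalIntegrable.congr (hcongr.mono uIoc_subset_uIcc) ?_
    have h := (hF.comp_sub_left (1 / 2)).comp_mul_left (c := 1 / 2)
    norm_num at h
    exact h.symm
  · rw [← intervalIntegral.integral_congr hcongr,
      intervalIntegral.integral_comp_sub_mul F (by norm_num : (1 / 2 : ℝ) ≠ 0),
      show (1 / 2 - 1 / 2 * 1 : ℝ) = 0 by norm_num,
      show (1 / 2 - 1 / 2 * (-1) : ℝ) = 1 by norm_num, intervalIntegral.integral_const_mul, hI,
      weightMass, Real.rpow_add_one two_ne_zero]
    norm_num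
    ring

lemma kreinIntegrand_eq {x : ℝ} (hx : x ∈ Icc (-1 : ℝ) 1) (m n s : ℕ) (α γ β : ℝ) :
    kreinIntegrand m n s α γ β x = (1 - x) ^ (α * β) * (1 + x) ^ (β * γ)
      * ((1 - 2 * X) ^ s * (jac n α (α + γ) * jac m α (α + γ))).eval (1 / 2 - 1 / 2 * x) := by
  have h1 : 0 ≤ 1 - x := by linarith [hx.2]
  have h2 : 0 ≤ 1 + x := by linarith [hx.1]
  rw [kreinIntegrand, jacobiWeight, Real.mul_rpow (Real.rpow_nonneg h1 _) (Real.rpow_nonneg h2 _),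
    ← Real.rpow_mul h1, ← Real.rpow_mul h2, mul_comm γ, jacobiP_eq_comp, jacobiP_eq_comp]
  simp only [eval_comp, eval_mul, eval_pow, eval_sub, eval_one, eval_X, eval_C, eval_ofNat]
  rw [show 1 / 2 * (1 - x) = 1 / 2 - 1 / 2 * x by ring,
    show 1 - 2 * (1 / 2 - 1 / 2 * x) = x by ring]
  ring

/-- The Krein-like functional converges and is a moment of `x ^ s P_m P_n`. -/
lemma krein_integral {α γ β : ℝ} (ha : -1 < α * β) (hb : -1 < β * γ) (m n s : ℕ) :
    IntervalIntegrable (kreinIntegrand m n s α γ β) volume (-1) 1 ∧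
    kreinFunctional m n s α γ β = weightMass (α * β) (β * γ) *
      mom (α * β + 1) (β * (α + γ) + 2)
        ((1 - 2 * X) ^ s * (jac n α (α + γ) * jac m α (α + γ))) := by
  obtain ⟨h1, h2⟩ := jacobi_integral_polynomial ha hb
    ((1 - 2 * X) ^ s * (jac n α (α + γ) * jac m α (α + γ)))
  have hcongr : EqOn (kreinIntegrand m n s α γ β) _ (uIcc (-1) 1) := fun x hx =>
    kreinIntegrand_eq (by rwa [Set.uIcc_of_le (by norm_num : (-1 : ℝ) ≤ 1)] at hx) m n s α γ β
  refine ⟨h1.congr (hcongr.symm.mono uIoc_subset_uIcc), ?_⟩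
  rw [kreinFunctional, intervalIntegral.integral_congr hcongr, h2,
    show α * β + β * γ = β * (α + γ) by ring]

/-! ### Continuity in the parameters, and the limit. -/

lemma continuousAt_rf {T : Type*} [TopologicalSpace T] {f : T → ℝ} {t : T}
    (hf : ContinuousAt f t) (n : ℕ) : ContinuousAt (fun x => rf (f x) n) t :=
  (continuous_rf n).continuousAt.comp hf

lemma continuousAt_mom {T : Type*} [TopologicalSpace T] {u v : T → ℝ} {t : T}
    (hu : ContinuousAt u t) (hv : ContinuousAt v t) (h0 : 0 < v t) (Q : ℝ[X]) :
    ContinuousAt (fun x => mom (u x) (v x) Q) t := by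
  simp only [mom_eq_sum, Polynomial.sum]
  refine tendsto_finsetSum _ fun i _ => ?_
  exact ((continuousAt_rf hu i).div (continuousAt_rf hv i) (rf_ne_zero h0 i)).const_mul _

lemma continuousAt_jacCoeff {T : Type*} [TopologicalSpace T] {a l : T → ℝ} {t : T}
    (ha : ContinuousAt a t) (hl : ContinuousAt l t) (n k : ℕ) :
    ContinuousAt (fun x => jacCoeff n (a x) (l x) k) t := by
  have h1 := continuousAt_rf (f := fun x => l x + n + 1) (t := t) (by fun_prop) k
  have h2 := continuousAt_rf (f := fun x => a x + k + 1) (t := t) (by fun_prop) (n - k)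
  unfold jacCoeff
  fun_prop

lemma continuousAt_weightMass {T : Type*} [TopologicalSpace T] {a b : T → ℝ} {t : T}
    (ha : ContinuousAt a t) (hb : ContinuousAt b t) (ha' : -1 < a t) (hb' : -1 < b t) :
    ContinuousAt (fun x => weightMass (a x) (b x)) t := by
  have hG : ∀ f : T → ℝ, ContinuousAt f t → 0 < f t →
      ContinuousAt (fun x => Real.Gamma (f x)) t := fun f hf h =>
    ContinuousAt.comp (f := f) (g := Real.Gamma) (Real.differentiableAt_Gamma fun m => by
      have : (0 : ℝ) ≤ m := m.cast_nonneg
      linarith).continuousAt hf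
  have h1 := hG (fun x => a x + 1) (by fun_prop) (by linarith)
  have h2 := hG (fun x => b x + 1) (by fun_prop) (by linarith)
  have h3 := hG (fun x => a x + b x + 2) (by fun_prop) (by linarith)
  have h4 : ContinuousAt (fun x => (2 : ℝ) ^ (a x + b x + 1)) t :=
    (Real.continuous_const_rpow two_ne_zero).continuousAt.comp (by fun_prop)
  exact h4.mul ((h1.mul h2).div h3 (Real.Gamma_pos_of_pos (by linarith)).ne')

/-- Moments of a product of Jacobi polynomials depend continuously on the parameters. -/
lemma continuousAt_mom_jac {T : Type*} [TopologicalSpace T] {u v a l : T → ℝ} {t : T}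
    (hu : ContinuousAt u t) (hv : ContinuousAt v t) (h0 : 0 < v t)
    (ha : ContinuousAt a t) (hl : ContinuousAt l t) (Q : ℝ[X]) (m n : ℕ) :
    ContinuousAt (fun x => mom (u x) (v x) (Q * (jac n (a x) (l x) * jac m (a x) (l x)))) t := by
  -- Here the polynomial varies with the parameters too; expanding it leaves moments of fixed
  -- polynomials with continuous coefficients.
  have : ∀ x, mom (u x) (v x) (Q * (jac n (a x) (l x) * jac m (a x) (l x)))
      = ∑ i ∈ range (n + 1), ∑ j ∈ range (m + 1), jacCoeff n (a x) (l x) i *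
        (jacCoeff m (a x) (l x) j * mom (u x) (v x) (Q * (X ^ i * X ^ j))) := by
    intro x
    simp only [jac]
    rw [sum_mul_sum]
    simp only [mul_sum, map_sum, smul_mul_assoc, mul_smul_comm, map_smul,
      smul_eq_mul]
    exact sum_congr rfl fun i _ => sum_congr rfl fun j _ => mul_left_comm _ _ _
  simp only [this]
  refine tendsto_finsetSum _ fun i _ => tendsto_finsetSum _ fun j _ => ?_
  exact (continuousAt_jacCoeff ha hl n i).mul
    ((continuousAt_jacCoeff ha hl m j).mul (continuousAt_mom hu hv h0 _))

end JacobiKrein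

end

theorem theorem9 (m n s : ℕ) (α γ β : ℝ) (hα : -1 < α) (hγ : -1 < γ) (hβ : 0 < β)
    (hαβ : -1 / β < α) (hγβ : -1 / β < γ) :
    IntervalIntegrable (JacobiKrein.kreinIntegrand m n s α γ β) MeasureTheory.volume (-1) 1 ∧
    ((α, γ, β) ∈ JacobiKrein.regularParams →
      JacobiKrein.kreinFunctional m n s α γ β = JacobiKrein.kreinSum m n s α γ β) ∧
    Filter.Tendsto (fun p : ℝ × ℝ × ℝ => JacobiKrein.kreinSum m n s p.1 p.2.1 p.2.2)
      (𝓝[JacobiKrein.regularParams] (α, γ, β))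
      (𝓝 (JacobiKrein.kreinFunctional m n s α γ β)) := by
  have ha : -1 < α * β := (div_lt_iff₀ hβ).1 hαβ
  have hb : -1 < β * γ := by
    rw [mul_comm]
    exact (div_lt_iff₀ hβ).1 hγβ
  obtain ⟨hi, hI⟩ := JacobiKrein.krein_integral ha hb m n s
  refine ⟨hi, fun h => by rw [hI, JacobiKrein.kreinSum_eq_mom hα hγ ha hb h.1 h.2], ?_⟩
  have c1 : ContinuousAt (fun p : ℝ × ℝ × ℝ => p.1) (α, γ, β) := by fun_prop
  have c2 : ContinuousAt (fun p : ℝ × ℝ × ℝ => p.2.1) (α, γ, β) := by fun_prop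
  have c3 : ContinuousAt (fun p : ℝ × ℝ × ℝ => p.1 * p.2.2) (α, γ, β) := by fun_prop
  have c4 : ContinuousAt (fun p : ℝ × ℝ × ℝ => p.2.2 * p.2.1) (α, γ, β) := by fun_prop
  have c5 : ContinuousAt (fun p : ℝ × ℝ × ℝ => p.1 * p.2.2 + 1) (α, γ, β) := by fun_prop
  have c6 : ContinuousAt (fun p : ℝ × ℝ × ℝ => p.2.2 * (p.1 + p.2.1) + 2) (α, γ, β) := by
    fun_prop
  have c7 : ContinuousAt (fun p : ℝ × ℝ × ℝ => p.1 + p.2.1) (α, γ, β) := by fun_prop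
  have hcont := (JacobiKrein.continuousAt_weightMass c3 c4 ha hb).mul
    (JacobiKrein.continuousAt_mom_jac c5 c6 (show 0 < β * (α + γ) + 2 by linarith) c1 c7
      ((1 - 2 * Polynomial.X) ^ s) m n)
  rw [hI]
  refine (hcont.tendsto.mono_left nhdsWithin_le_nhds).congr' ?_
  -- The inequalities used by `kreinSum_eq_mom` are open conditions, so they persist near the given
  -- parameters, and the sum equals the moment at regular points there.
  filter_upwards [self_mem_nhdsWithin, nhdsWithin_le_nhds (c1.eventually (lt_mem_nhds hα)),
    nhdsWithin_le_nhds (c2.eventually (lt_mem_nhds hγ)),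
    nhdsWithin_le_nhds (c3.eventually (lt_mem_nhds ha)),
    nhdsWithin_le_nhds (c4.eventually (lt_mem_nhds hb))] with p hp h1 h2 h3 h4
  exact (JacobiKrein.kreinSum_eq_mom h1 h2 h3 h4 hp.1 hp.2 m n s).symm
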